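/- Fix $L\ge 1$, connected finite simple graphs $H_1,\dots,H_L$ (not depending on $n$), where $H_1$ is a single edge and $H_\ell$ has $v_\ell\ge 2$ vertices and $e_\ell$ edges, and $\beta=(\beta_1,\dots,\beta_L)\in\mathbb R^L$. For $n\ge\max_\ell v_\ell$ let $N=n(n-1)/2$, and encode a labelled simple graph on $n$ vertices by its edge indicators $x=(x^{(s)})_s\in\{0,1\}^N$, where $s$ ranges over the $N$ vertex pairs. Let $t(H_\ell,x)$ be the number of injections of $V(H_\ell)$ into the vertex set of $x$ that map edges of $H_\ell$ to edges of $x$, and $$t_\ell(x)=\frac{t(H_\ell,x)}{n(n-1)\cdots(n-v_\ell+3)}$$ (the denominator has $v_\ell-2$ factors, and is $1$ for $v_\ell=2$). The model $\mathrm{ERGM}(\beta,t)$ on $n$ vertices is the probability measure $q_n$ on $\{0,1\}^N$ with $q_n(x)\propto\exp\big(\sum_{\ell=1}^L\beta_\ell t_\ell(x)\big)$. Its Glauber dynamics is the discrete time Markov chain on $\{0,1\}^N$ which in each step chooses a vertex pair $s$ uniformly among all $N$ pairs and resamples $x^{(s)}$ from its conditional distribution under $q_n$ given all the other edge indicators.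 Put $$\Phi(a)=\sum_{\ell=1}^L\beta_\ell e_\ell a^{e_\ell-1},\qquad |\Phi|(a)=\sum_{\ell=1}^L|\beta_\ell| e_\ell a^{e_\ell-1},\qquad \varphi(a)=\frac{1+\tanh(\Phi(a))}{2},$$ and assume that there is a unique $a^*\in[0,1]$ with $\varphi(a^*)=a^*$, and that $\tfrac12|\Phi|'(1)<1$. For each $n\ge\max_\ell v_\ell$ let $(X_n(u))_{u=0,1,2,\dots}$ be the Glauber dynamics of $\mathrm{ERGM}(\beta,t)$ on $n$ vertices in its stationary regime, that is, started from $X_n(0)\sim q_n$. Let $d_H(x,y)=\sum_{s}|x^{(s)}-y^{(s)}|$ be the Hamming distance. Then the expected Hamming distance between two consecutive states converges to $2a^*(1-a^*)$: for every choice of times $u_n\in\{0,1,2,\dots\}$, $$\lim_{n\to\infty}\mathbb E\, d_H\big(X_n(u_n),X_n(u_n+1)\big)=2a^*(1-a^*).$$ -/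

import Mathlib

open Filter Topology MeasureTheory

/-- The unordered vertex pairs `s = (i, j)`, `i < j`, of the vertex set `{0, …, n - 1}`;
there are `N = n (n - 1) / 2` of them. -/
abbrev VertexPair (n : ℕ) : Type := {p : Fin n × Fin n // p.1 < p.2}

/-- A labelled simple graph on `n` vertices, encoded by its edge indicators `x ∈ {0, 1}^N`. -/
abbrev GraphConfig (n : ℕ) : Type := VertexPair n → Bool

/-- `t(H, x)`: the number of injections `σ` from the vertices of `H` to those of `x` which map
every edge of `H` to an edge of `x`. -/
noncomputable def injCount {v n : ℕ} (H : SimpleGraph (Fin v)) (x : GraphConfig n) : ℕ :=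
  Nat.card {σ : Fin v ↪ Fin n //
    ∀ a b, H.Adj a b → ∀ h : σ a < σ b, x ⟨(σ a, σ b), h⟩ = true}

/-- `t_H(x) = t(H, x) / (n (n - 1) ⋯ (n - v + 3))`; the denominator has `v - 2` factors. -/
noncomputable def scaledCount {v n : ℕ} (H : SimpleGraph (Fin v)) (x : GraphConfig n) : ℝ :=
  (injCount H x : ℝ) / (n.descFactorial (v - 2) : ℝ)

/-- The data of a family of exponential random graph models: finitely many connected graphs
`H_ℓ`, the first one being a single edge, with real parameters `β_ℓ`. -/
structure ERGM where
  /-- the number of graphs is `k + 1` -/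
  k : ℕ
  v : Fin (k + 1) → ℕ
  H : (l : Fin (k + 1)) → SimpleGraph (Fin (v l))
  β : Fin (k + 1) → ℝ
  connected : ∀ l, (H l).Connected
  two_le : ∀ l, 2 ≤ v l
  /-- a connected graph on two vertices is a single edge -/
  first_edge : v 0 = 2

namespace ERGM

variable (M : ERGM)

/-- The number `e_ℓ` of edges of `H_ℓ`. -/
noncomputable def numEdges (l : Fin (M.k + 1)) : ℕ := (M.H l).edgeSet.ncard

/-- The unnormalised density `exp (∑ β_ℓ t_ℓ(x))`. -/
noncomputable def weight {n : ℕ} (x : GraphConfig n) : ℝ :=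
  Real.exp (∑ l, M.β l * scaledCount (M.H l) x)

/-- The probability of `x` under the exponential random graph model on `n` vertices. -/
noncomputable def prob {n : ℕ} (x : GraphConfig n) : ℝ :=
  M.weight x / ∑ y : GraphConfig n, M.weight y

/-- The conditional probability that the pair `s` is an edge given all other edge indicators
of `x`. -/
noncomputable def condProb {n : ℕ} (s : VertexPair n) (x : GraphConfig n) : ℝ :=
  M.prob (Function.update x s true) /
    (M.prob (Function.update x s true) + M.prob (Function.update x s false))

/-- One step of the Glauber dynamics: choose a pair `s` uniformly among all `N` pairs, and
resample its edge indicator from the conditional distribution given all the others. -/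
noncomputable def transition {n : ℕ} (x y : GraphConfig n) : ℝ :=
  (1 / (Fintype.card (VertexPair n) : ℝ)) * ∑ s : VertexPair n,
    (M.condProb s x * (if y = Function.update x s true then 1 else 0) +
      (1 - M.condProb s x) * (if y = Function.update x s false then 1 else 0))

/-- The process `X 0, X 1, …` is the (discrete time, stationary) Glauber dynamics of the model on
`n` vertices: it is a Markov chain with the above transition probabilities, and `X 0` follows
the model. -/
structure IsGlauberDynamics {n : ℕ} {Ω : Type*} [MeasurableSpace Ω] (P : Measure Ω)
    (X : ℕ → Ω → GraphConfig n) : Prop where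
  measurable : ∀ u, Measurable (X u)
  law : ∀ (m : ℕ) (x : ℕ → GraphConfig n),
    P.real {ω | ∀ i ≤ m, X i ω = x i} =
      M.prob (x 0) * ∏ i ∈ Finset.range m, M.transition (x i) (x (i + 1))

/-- `Φ(a) = ∑ β_ℓ e_ℓ a^(e_ℓ - 1)`. -/
noncomputable def Phi (a : ℝ) : ℝ := ∑ l, M.β l * M.numEdges l * a ^ (M.numEdges l - 1)

/-- `|Φ|(a) = ∑ |β_ℓ| e_ℓ a^(e_ℓ - 1)`. -/
noncomputable def absPhi (a : ℝ) : ℝ := ∑ l, |M.β l| * M.numEdges l * a ^ (M.numEdges l - 1)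

/-- `φ(a) = (1 + tanh (Φ(a))) / 2`. -/
noncomputable def phi (a : ℝ) : ℝ := (1 + Real.tanh (M.Phi a)) / 2

/-- The number `a` is the unique solution in `[0, 1]` of `φ(a) = a`, and `|Φ|'(1) / 2 < 1`. -/
structure HighTemperature (a : ℝ) : Prop where
  mem : a ∈ Set.Icc (0 : ℝ) 1
  fixed : M.phi a = a
  unique : ∀ b ∈ Set.Icc (0 : ℝ) 1, M.phi b = b → b = a
  contraction : 1 / 2 * deriv M.absPhi 1 < 1

end ERGM

/-! By stationarity the expectation is that of one step from the model measure. Given the other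
edges, the old and the new value at the chosen pair `s` are independent with the same parameter
`p_s`, so they differ with probability `2 p_s (1 - p_s)` (`sum_prob_mul_hammingDist`). It remains to
show that the average of this quantity over `s` has mean close to its value at `p_s = a`.

For this the model is compared with the product measure of parameter `a`. The log-odds of `p_s` are
a normalised count of copies of the `H_ℓ` through `s` (`condProb_eq_sigmoid`). Two facts follow. (1)
The total influence of one edge on the conditional probabilities of the others is at most `δ =
|Φ|'(1) / 2 < 1` (`sum_abs_condProb_sub_le`), so Dobrushin's comparison `abs_sum_sub_sum_le` bounds
the difference of two expectations by the mean discrepancy of the conditional probabilities under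
the product measure. (2) Under the product measure these counts concentrate at `2 Φ(a)` by a second
moment bound, so `p_s` is close to `φ(a) = a` (`sum_bern_mul_abs_condProb_sub_le`). The average over
`s` has Lipschitz constant of order `1 / N`, which absorbs the sum over `N` coordinates in the
comparison, and the remaining error tends to zero. -/

namespace Glauber

/-! ### Glauber dynamics on the cube and Dobrushin comparison -/

section HeatBath

variable {R : Type*} [DecidableEq R]

/-- The conditional probability under `μ` that the coordinate `s` is `true`, given the others. -/
noncomputable def condTrue (μ : (R → Bool) → ℝ) (s : R) (x : R → Bool) : ℝ :=
  μ (Function.update x s true) / (μ (Function.update x s true) + μ (Function.update x s false))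

/-- Resampling of the coordinate `s`, which becomes `true` with probability `p s x`. -/
def resample (p : R → (R → Bool) → ℝ) (s : R) (f : (R → Bool) → ℝ) (x : R → Bool) : ℝ :=
  p s x * f (Function.update x s true) + (1 - p s x) * f (Function.update x s false)

/-- Changing one coordinate changes `f` by at most `K`. -/
def FlipLipschitz (K : ℝ) (f : (R → Bool) → ℝ) : Prop :=
  ∀ x r, |f (Function.update x r true) - f (Function.update x r false)| ≤ K

theorem condTrue_update (μ : (R → Bool) → ℝ) (s : R) (x : R → Bool) (b : Bool) :
    condTrue μ s (Function.update x s b) = condTrue μ s x := by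
  simp [condTrue]

theorem condTrue_mem {μ : (R → Bool) → ℝ} (hμ : ∀ x, 0 < μ x) (s : R) (x : R → Bool) :
    condTrue μ s x ∈ Set.Icc (0 : ℝ) 1 := by
  have h1 := hμ (Function.update x s true)
  have h2 := hμ (Function.update x s false)
  refine ⟨by unfold condTrue; positivity, ?_⟩
  unfold condTrue
  rw [div_le_one (by positivity)]
  linarith

variable [Fintype R]

/-- Resampling of a uniformly chosen coordinate. -/
noncomputable def glauber (p : R → (R → Bool) → ℝ) (f : (R → Bool) → ℝ) (x : R → Bool) : ℝ :=
  (1 / (Fintype.card R : ℝ)) * ∑ s, resample p s f x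

/-- Flipping the coordinate `s` permutes the cube. This reduces an identity between sums to one on
each pair of configurations differing only at `s`. -/
theorem two_mul_sum_eq_sum_update (s : R) (f : (R → Bool) → ℝ) :
    2 * ∑ x, f x = ∑ x, (f (Function.update x s true) + f (Function.update x s false)) := by
  have hinv : Function.Involutive (fun x : R → Bool => Function.update x s (!x s)) := by
    intro x
    simp
  have h : ∑ x, f (Function.update x s (!x s)) = ∑ x, f x :=
    Equiv.sum_comp hinv.toPerm f
  rw [two_mul]
  nth_rewrite 2 [← h]
  rw [← Finset.sum_add_distrib]
  refine Finset.sum_congr rfl fun x _ => ?_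
  cases hx : x s
  · nth_rewrite 1 [← Function.update_eq_self s x]
    rw [hx, add_comm]; rfl
  · nth_rewrite 1 [← Function.update_eq_self s x]
    rw [hx]; rfl

/-- Resampling redistributes the mass of each pair differing at `s` in the proportions that `μ`
already gives it. -/
theorem sum_mul_resample {μ : (R → Bool) → ℝ} (hμ : ∀ x, 0 < μ x) (s : R)
    (f : (R → Bool) → ℝ) :
    ∑ x, μ x * resample (condTrue μ) s f x = ∑ x, μ x * f x := by
  refine mul_left_cancel₀ (two_ne_zero (α := ℝ)) ?_
  rw [two_mul_sum_eq_sum_update s, two_mul_sum_eq_sum_update s]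
  refine Finset.sum_congr rfl fun x _ => ?_
  have h1 := hμ (Function.update x s true)
  have h2 := hμ (Function.update x s false)
  simp only [resample, condTrue, Function.update_idem]
  field_simp
  ring

theorem sum_mul_glauber [Nonempty R] {μ : (R → Bool) → ℝ} (hμ : ∀ x, 0 < μ x)
    (f : (R → Bool) → ℝ) :
    ∑ x, μ x * glauber (condTrue μ) f x = ∑ x, μ x * f x := by
  have hN : (Fintype.card R : ℝ) ≠ 0 := by exact_mod_cast Fintype.card_ne_zero
  calc ∑ x, μ x * glauber (condTrue μ) f x
      = (1 / (Fintype.card R : ℝ)) * ∑ s, ∑ x, μ x * resample (condTrue μ) s f x := by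
        rw [Finset.sum_comm, Finset.mul_sum]
        refine Finset.sum_congr rfl fun x _ => ?_
        rw [← Finset.mul_sum, glauber]
        ring
    _ = ∑ x, μ x * f x := by
        simp only [sum_mul_resample hμ, Finset.sum_const, Finset.card_univ, nsmul_eq_mul]
        field_simp

theorem FlipLipschitz.abs_sub_le_mul_card {K : ℝ} {f : (R → Bool) → ℝ} (hf : FlipLipschitz K f)
    (x y : R → Bool) : |f x - f y| ≤ K * Fintype.card R := by
  have step : ∀ (z : R → Bool) (r : R) (b : Bool), |f (Function.update z r b) - f z| ≤ K := by
    intro z r b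
    have h := hf z r
    have hK : 0 ≤ K := (abs_nonneg _).trans h
    have hz : f z = f (Function.update z r (z r)) := by rw [Function.update_eq_self]
    rw [hz]
    cases b <;> cases z r
    · simpa using hK
    · rwa [abs_sub_comm]
    · exact h
    · simpa using hK
  have key : ∀ S : Finset R, |f (S.piecewise x y) - f y| ≤ K * S.card := by
    intro S
    induction S using Finset.induction_on with
    | empty => simp
    | insert j S hj ih =>
      rw [Finset.piecewise_insert, Finset.card_insert_of_notMem hj]
      have h1 := step (S.piecewise x y) j (x j)
      have h2 := abs_sub_le (f (Function.update (S.piecewise x y) j (x j)))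
        (f (S.piecewise x y)) (f y)
      push_cast
      linarith
  simpa using key Finset.univ

/-- Start from two configurations differing at `r`. Choosing `r` erases the difference. Choosing `s
≠ r` keeps it, at cost `K`, and adds `K` times the discrepancy of the conditional probabilities at
`s`. The total is `K (N - 1 + δ) / N`. -/
theorem FlipLipschitz.comp_glauber [Nonempty R] {μ : (R → Bool) → ℝ} (hμ : ∀ x, 0 < μ x) {δ : ℝ}
    (hδ : ∀ r z, ∑ s ∈ Finset.univ.erase r, |condTrue μ s (Function.update z r true) -
      condTrue μ s (Function.update z r false)| ≤ δ)
    {K : ℝ} {f : (R → Bool) → ℝ} (hf : FlipLipschitz K f) :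
    FlipLipschitz (K * (1 - (1 - δ) / Fintype.card R)) (glauber (condTrue μ) f) := by
  intro z r
  have hN : (0 : ℝ) < Fintype.card R := by exact_mod_cast Fintype.card_pos
  have hK : 0 ≤ K := (abs_nonneg _).trans (hf z r)
  set x := Function.update z r true with hx
  set y := Function.update z r false with hy
  have hr : resample (condTrue μ) r f x - resample (condTrue μ) r f y = 0 := by
    simp [hx, hy, resample, condTrue_update]
  have hs : ∀ s ∈ Finset.univ.erase r,
      |resample (condTrue μ) s f x - resample (condTrue μ) s f y| ≤
        K * (1 + |condTrue μ s x - condTrue μ s y|) := by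
    intro s hs
    have hsr : s ≠ r := Finset.ne_of_mem_erase hs
    have e1 : ∀ b c, Function.update (Function.update z r b) s c =
        Function.update (Function.update z s c) r b := fun b c =>
      Function.update_comm hsr.symm b c z
    have d1 : |f (Function.update x s true) - f (Function.update y s true)| ≤ K := by
      rw [hx, hy, e1, e1]; exact hf _ _
    have d2 : |f (Function.update x s false) - f (Function.update y s false)| ≤ K := by
      rw [hx, hy, e1, e1]; exact hf _ _
    have d3 := hf y s
    obtain ⟨p0, p1⟩ := condTrue_mem hμ s x
    have e2 : resample (condTrue μ) s f x - resample (condTrue μ) s f y =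
        condTrue μ s x * (f (Function.update x s true) - f (Function.update y s true)) +
        (1 - condTrue μ s x) * (f (Function.update x s false) - f (Function.update y s false)) +
        (condTrue μ s x - condTrue μ s y) *
          (f (Function.update y s true) - f (Function.update y s false)) := by
      simp only [resample]; ring
    rw [e2]
    refine (abs_add_three _ _ _).trans ?_
    rw [abs_mul, abs_mul, abs_mul, abs_of_nonneg p0, abs_of_nonneg (sub_nonneg.2 p1)]
    have b1 := mul_le_mul_of_nonneg_left d1 p0
    have b2 := mul_le_mul_of_nonneg_left d2 (sub_nonneg.2 p1)
    have b3 := mul_le_mul_of_nonneg_left d3 (abs_nonneg (condTrue μ s x - condTrue μ s y))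
    linarith
  have hsum : |∑ s, (resample (condTrue μ) s f x - resample (condTrue μ) s f y)| ≤
      K * (Fintype.card R - 1 + δ) := by
    rw [← Finset.add_sum_erase _ _ (Finset.mem_univ r), hr, zero_add]
    refine (Finset.abs_sum_le_sum_abs _ _).trans ((Finset.sum_le_sum hs).trans ?_)
    rw [← Finset.mul_sum, Finset.sum_add_distrib, Finset.sum_const,
      Finset.card_erase_of_mem (Finset.mem_univ r), Finset.card_univ, nsmul_eq_mul, mul_one,
      Nat.cast_sub Fintype.card_pos, Nat.cast_one]
    exact mul_le_mul_of_nonneg_left (by linarith [hδ r z]) hK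
  unfold glauber
  rw [← mul_sub, ← Finset.sum_sub_distrib, abs_mul, abs_of_pos (by positivity)]
  calc _ ≤ 1 / (Fintype.card R : ℝ) * (K * (Fintype.card R - 1 + δ)) :=
        mul_le_mul_of_nonneg_left hsum (by positivity)
    _ = _ := by field_simp; ring

/-- Dobrushin's comparison of `μ` with another measure `ν` of full support. -/
theorem abs_sum_sub_sum_le [Nonempty R] {μ ν : (R → Bool) → ℝ} (hμ : ∀ x, 0 < μ x)
    (hν : ∀ x, 0 < ν x) (hμ1 : ∑ x, μ x = 1) (hν1 : ∑ x, ν x = 1) {δ : ℝ} (hδ1 : δ < 1)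
    (hδ : ∀ r z, ∑ s ∈ Finset.univ.erase r, |condTrue μ s (Function.update z r true) -
      condTrue μ s (Function.update z r false)| ≤ δ)
    {K : ℝ} {f : (R → Bool) → ℝ} (hf : FlipLipschitz K f) :
    |∑ x, μ x * f x - ∑ x, ν x * f x| ≤
      K / (1 - δ) * ∑ s, ∑ x, ν x * |condTrue μ s x - condTrue ν s x| := by
  have hN : (1 : ℝ) ≤ Fintype.card R := by exact_mod_cast Fintype.card_pos
  have hδ0 : 0 ≤ δ := (Finset.sum_nonneg fun _ _ => abs_nonneg _).trans
    (hδ (Classical.arbitrary R) fun _ => true)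
  set N : ℝ := (Fintype.card R : ℝ) with hNdef
  set ρ : ℝ := 1 - (1 - δ) / N with hρ
  set ε : ℝ := ∑ s, ∑ x, ν x * |condTrue μ s x - condTrue ν s x| with hε
  have hρ0 : 0 ≤ ρ := by
    rw [hρ, sub_nonneg, div_le_one (by linarith)]; linarith
  have hρ1 : ρ < 1 := by
    have : 0 < (1 - δ) / N := div_pos (by linarith) (by linarith)
    linarith
  -- `K` and `f` stay general because the induction passes to `glauber f`, with constant `K ρ`. At
  -- `m = 0` the term `2 N` is crude: each mean is within `K N` of the value of `f` at one point.
  have main : ∀ (m : ℕ) (K : ℝ) (f : (R → Bool) → ℝ), FlipLipschitz K f →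
      |∑ x, μ x * f x - ∑ x, ν x * f x| ≤ K * (2 * N * ρ ^ m + ε / (1 - δ)) := by
    intro m
    induction m with
    | zero =>
      intro K f hf
      have hε0 : 0 ≤ ε := Finset.sum_nonneg fun s _ => Finset.sum_nonneg fun x _ =>
        mul_nonneg (hν x).le (abs_nonneg _)
      have hK : 0 ≤ K := (abs_nonneg _).trans (hf (fun _ => true) (Classical.arbitrary R))
      have dev : ∀ {κ : (R → Bool) → ℝ}, (∀ x, 0 < κ x) → ∑ x, κ x = 1 →
          |∑ x, κ x * f x - f fun _ => true| ≤ K * N := by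
        intro κ hκ hκ1
        have e : ∑ x, κ x * f x - f (fun _ => true) = ∑ x, κ x * (f x - f fun _ => true) := by
          simp only [mul_sub, Finset.sum_sub_distrib, ← Finset.sum_mul, hκ1, one_mul]
        rw [e]
        calc _ ≤ ∑ x, |κ x * (f x - f fun _ => true)| := Finset.abs_sum_le_sum_abs _ _
          _ ≤ ∑ x, κ x * (K * N) := Finset.sum_le_sum fun x _ => by
              rw [abs_mul, abs_of_pos (hκ x)]
              exact mul_le_mul_of_nonneg_left (hf.abs_sub_le_mul_card _ _) (hκ x).le
          _ = K * N := by rw [← Finset.sum_mul, hκ1, one_mul]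
      have h1 := dev hμ hμ1
      have h2 := dev hν hν1
      rw [abs_sub_comm] at h2
      have h3 := abs_sub_le (∑ x, μ x * f x) (f fun _ => true) (∑ x, ν x * f x)
      have h4 : 0 ≤ K * (ε / (1 - δ)) := mul_nonneg hK (div_nonneg hε0 (by linarith))
      rw [pow_zero]
      linarith
    | succ m ih =>
      intro K f hf
      have h1 := ih _ _ (hf.comp_glauber hμ hδ)
      -- As `ν` is stationary for its own dynamics, only the difference between the two dynamics
      -- counts.
      have h2 : |∑ x, ν x * glauber (condTrue μ) f x - ∑ x, ν x * f x| ≤ K * (1 / N * ε) := by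
        rw [← sum_mul_glauber hν f, ← Finset.sum_sub_distrib]
        calc _ ≤ ∑ x, |ν x * glauber (condTrue μ) f x - ν x * glauber (condTrue ν) f x| :=
              Finset.abs_sum_le_sum_abs _ _
          _ ≤ ∑ x, ν x * (1 / N * ∑ s, |condTrue μ s x - condTrue ν s x| * K) := by
              refine Finset.sum_le_sum fun x _ => ?_
              rw [← mul_sub, abs_mul, abs_of_pos (hν x)]
              refine mul_le_mul_of_nonneg_left ?_ (hν x).le
              unfold glauber
              rw [← mul_sub, ← Finset.sum_sub_distrib, abs_mul, abs_of_pos (by positivity)]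
              refine mul_le_mul_of_nonneg_left ?_ (by positivity)
              refine (Finset.abs_sum_le_sum_abs _ _).trans (Finset.sum_le_sum fun s _ => ?_)
              have e : resample (condTrue μ) s f x - resample (condTrue ν) s f x =
                  (condTrue μ s x - condTrue ν s x) *
                    (f (Function.update x s true) - f (Function.update x s false)) := by
                simp only [resample]; ring
              rw [e, abs_mul]
              exact mul_le_mul_of_nonneg_left (hf x s) (abs_nonneg _)
          _ = K * (1 / N * ε) := by
              rw [hε, Finset.sum_comm]
              simp only [Finset.mul_sum]
              refine Finset.sum_congr rfl fun x _ => Finset.sum_congr rfl fun s _ => ?_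
              ring
      rw [sum_mul_glauber hμ] at h1
      have h3 := abs_sub_le (∑ x, μ x * f x) (∑ x, ν x * glauber (condTrue μ) f x)
        (∑ x, ν x * f x)
      refine h3.trans ((add_le_add h1 h2).trans (le_of_eq ?_))
      have h4 : 1 - δ ≠ 0 := by linarith
      have h5 : N ≠ 0 := by linarith
      -- The additive error `ε / (1 - δ)` is the fixed point of `t ↦ ρ t + ε / N`.
      have h6 : ρ * (ε / (1 - δ)) + 1 / N * ε = ε / (1 - δ) := by
        rw [hρ]; field_simp; ring
      rw [← hρ, pow_succ]
      linear_combination K * h6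
  have hlim : Tendsto (fun m : ℕ => K * (2 * N * ρ ^ m + ε / (1 - δ))) atTop
      (𝓝 (K * (2 * N * 0 + ε / (1 - δ)))) :=
    (((tendsto_pow_atTop_nhds_zero_of_lt_one hρ0 hρ1).const_mul _).add_const _).const_mul _
  have := ge_of_tendsto' hlim fun m => main m K f hf
  refine this.trans (le_of_eq ?_)
  ring

end HeatBath

end Glauber

namespace Glauber

/-! ### Monomials in the edge indicators and their discrete derivatives -/

section Monomials

variable {R : Type*}

/-- The indicator that all the coordinates in `S` are `true`. -/
noncomputable def mono (S : Finset R) (x : R → Bool) : ℝ := ∏ r ∈ S, if x r then 1 else 0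

theorem mono_eq (S : Finset R) (x : R → Bool) :
    mono S x = if ∀ r ∈ S, x r = true then 1 else 0 :=
  Finset.prod_ite_zero.trans (by simp)

theorem mono_mem (S : Finset R) (x : R → Bool) : mono S x ∈ Set.Icc (0 : ℝ) 1 := by
  rw [mono_eq]; split_ifs <;> simp

variable [DecidableEq R]

theorem mono_mul_mono (S T : Finset R) (x : R → Bool) :
    mono S x * mono T x = mono (S ∪ T) x := by
  simp only [mono_eq, ← ite_and, mul_ite, mul_one, mul_zero]
  refine if_congr ?_ rfl rfl
  simp only [Finset.mem_union]
  exact ⟨fun h r hr => hr.elim (h.2 r) (h.1 r), fun h => ⟨fun r hr => h r (.inr hr),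
    fun r hr => h r (.inl hr)⟩⟩

theorem mono_update_of_notMem {S : Finset R} {s : R} (hs : s ∉ S) (x : R → Bool) (b : Bool) :
    mono S (Function.update x s b) = mono S x :=
  Finset.prod_congr rfl fun r hr => by
    rw [Function.update_of_ne (ne_of_mem_of_not_mem hr hs)]

theorem mono_update_sub (S : Finset R) (s : R) (x : R → Bool) :
    mono S (Function.update x s true) - mono S (Function.update x s false) =
      if s ∈ S then mono (S.erase s) x else 0 := by
  split_ifs with h
  · have key : ∀ b, mono S (Function.update x s b) = (if b then 1 else 0) * mono (S.erase s) x := by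
      intro b
      rw [← mono_update_of_notMem (Finset.notMem_erase s S) x b]
      unfold mono
      rw [← Finset.mul_prod_erase S _ h, Function.update_self]
    simp [key]
  · rw [mono_update_of_notMem h, mono_update_of_notMem h, sub_self]

variable {I : Type*} [Fintype I]

/-- The number of sets `A i` containing `s` all of whose other elements are `true` in `x`. -/
noncomputable def localCount (A : I → Finset R) (s : R) (x : R → Bool) : ℝ :=
  ∑ i with s ∈ A i, mono ((A i).erase s) x

theorem sum_mono_update_sub (A : I → Finset R) (s : R) (x : R → Bool) :
    ∑ i, mono (A i) (Function.update x s true) - ∑ i, mono (A i) (Function.update x s false) =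
      localCount A s x := by
  rw [← Finset.sum_sub_distrib, localCount, Finset.sum_filter]
  exact Finset.sum_congr rfl fun i _ => mono_update_sub _ _ _

/-- This is a second difference, so only the sets containing both `r` and `s` contribute, each at
most 1. Each of the at most `d` sets through `r` is counted for its `e - 1` other elements. -/
theorem sum_abs_localCount_sub_le [Fintype R] {A : I → Finset R} {e d : ℕ}
    (he : ∀ i, (A i).card = e) (r : R) (hd : (Finset.univ.filter fun i => r ∈ A i).card ≤ d)
    (z : R → Bool) :
    ∑ s ∈ Finset.univ.erase r, |localCount A s (Function.update z r true) -
      localCount A s (Function.update z r false)| ≤ ((d * (e - 1) : ℕ) : ℝ) := by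
  calc _ ≤ ∑ s ∈ Finset.univ.erase r, ∑ i with r ∈ A i,
          (if s ∈ A i then 1 else 0 : ℝ) := by
        refine Finset.sum_le_sum fun s hs => ?_
        have hsr : s ≠ r := Finset.ne_of_mem_erase hs
        unfold localCount
        rw [← Finset.sum_sub_distrib, Finset.sum_filter, Finset.sum_filter]
        refine (Finset.abs_sum_le_sum_abs _ _).trans (Finset.sum_le_sum fun i _ => ?_)
        rw [mono_update_sub]
        have := mono_mem (((A i).erase s).erase r) z
        by_cases h1 : s ∈ A i <;> by_cases h2 : r ∈ A i <;>
          simp [h1, h2, hsr.symm, abs_of_nonneg this.1, this.2]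
    _ = ∑ i with r ∈ A i, (((A i).erase r).card : ℝ) := by
        rw [Finset.sum_comm]
        refine Finset.sum_congr rfl fun i _ => ?_
        rw [← Finset.sum_filter, Finset.sum_const, nsmul_eq_mul, mul_one]
        congr 2
        ext s
        simp [and_comm]
    _ = (((Finset.univ.filter fun i => r ∈ A i).card * (e - 1) : ℕ) : ℝ) := by
        rw [Finset.sum_congr rfl fun i hi => by
          rw [Finset.card_erase_of_mem (Finset.mem_filter.1 hi).2, he i]]
        simp
    _ ≤ _ := by exact_mod_cast Nat.mul_le_mul_right _ hd

end Monomials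

/-! ### Second moments under the product measure -/

section Bernoulli

variable {R : Type*} [Fintype R]

/-- The product measure under which every coordinate is `true` with probability `a`. -/
noncomputable def bern (a : ℝ) (x : R → Bool) : ℝ := ∏ r, if x r then a else 1 - a

theorem bern_pos {a : ℝ} (h0 : 0 < a) (h1 : a < 1) (x : R → Bool) : 0 < bern a x :=
  Finset.prod_pos fun r _ => by split_ifs <;> linarith

variable [DecidableEq R]

theorem condTrue_bern {a : ℝ} (h0 : 0 < a) (h1 : a < 1) (s : R) (x : R → Bool) :
    condTrue (bern a) s x = a := by
  have key : ∀ b, bern a (Function.update x s b) = (if b then a else 1 - a) *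
      ∏ r ∈ Finset.univ.erase s, (if x r then a else 1 - a) := by
    intro b
    unfold bern
    rw [← Finset.mul_prod_erase Finset.univ _ (Finset.mem_univ s), Function.update_self]
    congr 1
    refine Finset.prod_congr rfl fun r hr => ?_
    rw [Function.update_of_ne (Finset.ne_of_mem_erase hr)]
  have hpos : 0 < ∏ r ∈ Finset.univ.erase s, (if x r then a else 1 - a) :=
    Finset.prod_pos fun r _ => by split_ifs <;> linarith
  rw [condTrue, key, key, ← add_mul]
  simp [hpos.ne']

theorem sum_bern_mul_mono (a : ℝ) (S : Finset R) :
    ∑ x, bern a x * mono S x = a ^ S.card := by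
  have h : ∀ x : R → Bool, bern a x * mono S x =
      ∏ r, (if x r then a else 1 - a) * (if r ∈ S then if x r then 1 else 0 else 1) := by
    intro x
    rw [Finset.prod_mul_distrib, Finset.prod_ite_mem, Finset.univ_inter]
    rfl
  simp only [h]
  have h2 := Finset.prod_univ_sum (fun _ : R => (Finset.univ : Finset Bool))
    (fun r b => (if b then a else 1 - a) * (if r ∈ S then if b then 1 else 0 else 1))
  rw [Fintype.piFinset_univ] at h2
  rw [← h2]
  have h3 : ∀ r, ∑ b : Bool, (if b then a else 1 - a) *
      (if r ∈ S then if b then 1 else 0 else 1) = if r ∈ S then a else 1 := by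
    intro r
    by_cases hr : r ∈ S <;> simp [hr]
  simp only [h3]
  rw [Finset.prod_ite_mem, Finset.univ_inter, Finset.prod_const]

theorem sum_bern (a : ℝ) : ∑ x : R → Bool, bern a x = 1 := by
  simpa [mono] using sum_bern_mul_mono (R := R) a ∅

/-- The variance is a sum of covariances. Disjoint sets give independent monomials, and any other
covariance is at most 1. -/
theorem sum_bern_mul_sq_le {a : ℝ} (h0 : 0 ≤ a) (h1 : a ≤ 1) {I : Type*} (T : Finset I)
    (B : I → Finset R) (k : ℕ) (hk : ∀ i ∈ T, (B i).card = k) :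
    ∑ x, bern a x * (∑ i ∈ T, mono (B i) x - T.card * a ^ k) ^ 2 ≤
      ∑ i ∈ T, ((T.filter fun j => ¬ Disjoint (B i) (B j)).card : ℝ) := by
  have hmean : ∑ x, bern a x * ∑ i ∈ T, mono (B i) x = T.card * a ^ k := by
    simp only [Finset.mul_sum]
    rw [Finset.sum_comm, Finset.sum_congr rfl fun i hi => by rw [sum_bern_mul_mono, hk i hi]]
    simp
  have hsq : ∑ x, bern a x * (∑ i ∈ T, mono (B i) x) ^ 2 =
      ∑ i ∈ T, ∑ j ∈ T, a ^ (B i ∪ B j).card := by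
    simp only [pow_two, Finset.sum_mul_sum]
    simp only [mono_mul_mono, Finset.mul_sum]
    rw [Finset.sum_comm]
    refine Finset.sum_congr rfl fun i _ => ?_
    rw [Finset.sum_comm]
    exact Finset.sum_congr rfl fun j _ => sum_bern_mul_mono a _
  have hexp : ∑ x, bern a x * (∑ i ∈ T, mono (B i) x - T.card * a ^ k) ^ 2 =
      ∑ i ∈ T, ∑ j ∈ T, (a ^ (B i ∪ B j).card - a ^ k * a ^ k) := by
    have e : ∀ x : R → Bool, bern a x * (∑ i ∈ T, mono (B i) x - T.card * a ^ k) ^ 2 =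
        bern a x * (∑ i ∈ T, mono (B i) x) ^ 2 -
        2 * (T.card * a ^ k) * (bern a x * ∑ i ∈ T, mono (B i) x) +
        (T.card * a ^ k) ^ 2 * bern a x := fun x => by ring
    simp only [e, Finset.sum_add_distrib, Finset.sum_sub_distrib, ← Finset.mul_sum, hmean, hsq,
      sum_bern, Finset.sum_const, nsmul_eq_mul]
    ring
  rw [hexp]
  refine Finset.sum_le_sum fun i hi => ?_
  rw [Finset.card_filter, Nat.cast_sum]
  refine Finset.sum_le_sum fun j hj => ?_
  by_cases hd : Disjoint (B i) (B j)
  · rw [Finset.card_union_of_disjoint hd, hk i hi, hk j hj, pow_add]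
    simp [hd]
  · have e1 : a ^ (B i ∪ B j).card ≤ 1 := pow_le_one₀ h0 h1
    have e2 : 0 ≤ a ^ k * a ^ k := by positivity
    simp only [hd, not_false_eq_true, if_true, Nat.cast_one]
    linarith

/-- Cauchy–Schwarz reduces to the variance. A set meeting `(A i).erase s` shares with it one of `e -
1` elements `r`, and each `r` allows at most `c` sets. -/
theorem sum_bern_mul_abs_localCount_sub_le {a : ℝ} (h0 : 0 < a) (h1 : a < 1) {I : Type*}
    [Fintype I] {A : I → Finset R} {e d c : ℕ} (he : ∀ i, (A i).card = e) (s : R)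
    (hd : (Finset.univ.filter fun i => s ∈ A i).card = d)
    (hc : ∀ r ≠ s, (Finset.univ.filter fun i => s ∈ A i ∧ r ∈ A i).card ≤ c) :
    ∑ x, bern a x * |localCount A s x - d * a ^ (e - 1)| ≤
      √((d * ((e - 1) * c) : ℕ) : ℝ) := by
  classical
  have hvar := sum_bern_mul_sq_le h0.le h1.le (Finset.univ.filter fun i => s ∈ A i)
    (fun i => (A i).erase s) (e - 1) fun i hi => by
      rw [Finset.card_erase_of_mem (Finset.mem_filter.1 hi).2, he i]
  rw [hd] at hvar
  refine Real.le_sqrt_of_sq_le ?_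
  have hCS : (∑ x, bern a x * |localCount A s x - d * a ^ (e - 1)|) ^ 2 ≤
      ∑ x, bern a x * |localCount A s x - d * a ^ (e - 1)| ^ 2 :=
    Real.pow_arith_mean_le_arith_mean_pow Finset.univ _ _ (fun x _ => (bern_pos h0 h1 x).le)
      (sum_bern a) (fun _ _ => abs_nonneg _) 2
  simp only [sq_abs] at hCS
  refine hCS.trans (hvar.trans ?_)
  have hle : ∀ i ∈ (Finset.univ.filter fun i => s ∈ A i),
      ((Finset.univ.filter fun i => s ∈ A i).filter fun j =>
        ¬ Disjoint ((A i).erase s) ((A j).erase s)).card ≤ (e - 1) * c := by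
    intro i hi
    have hsub : ((Finset.univ.filter fun i => s ∈ A i).filter fun j =>
        ¬ Disjoint ((A i).erase s) ((A j).erase s)) ⊆
        ((A i).erase s).biUnion fun r => Finset.univ.filter fun i => s ∈ A i ∧ r ∈ A i := by
      intro j hj
      simp only [Finset.mem_filter, Finset.mem_univ, true_and, Finset.not_disjoint_iff] at hj
      obtain ⟨hj, r, hr1, hr2⟩ := hj
      simp only [Finset.mem_biUnion, Finset.mem_filter, Finset.mem_univ, true_and]
      exact ⟨r, hr1, hj, Finset.mem_of_mem_erase hr2⟩
    refine (Finset.card_le_card hsub).trans ?_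
    rw [← he i, ← Finset.card_erase_of_mem (Finset.mem_filter.1 hi).2]
    exact Finset.card_biUnion_le_card_mul _ _ _ fun r hr => hc r (Finset.ne_of_mem_erase hr)
  calc _ ≤ ∑ i with s ∈ A i, (((e - 1) * c : ℕ) : ℝ) :=
        Finset.sum_le_sum fun i hi => by exact_mod_cast hle i hi
    _ = _ := by simp [hd]

end Bernoulli

end Glauber

/-! ### Embeddings with prescribed values -/

section Embeddings

/-- Extensions of `h ∘ g⁻¹` to an embedding correspond to embeddings of the complements. -/
noncomputable def embeddingExtensionEquiv {ι α β : Type*} (g : ι ↪ α) (h : ι ↪ β) :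
    {σ : α ↪ β // ∀ i, σ (g i) = h i} ≃
      (((Set.range g)ᶜ : Set α) ↪ ((Set.range h)ᶜ : Set β)) := by
  classical
  exact
  { toFun := fun σ => ⟨fun x => ⟨σ.1 x, by
      rintro ⟨i, hi⟩
      rw [← σ.2 i] at hi
      exact x.2 ⟨i, σ.1.injective hi⟩⟩, fun x y hxy =>
        Subtype.ext (σ.1.injective (congrArg Subtype.val hxy))⟩
    invFun := fun τ => ⟨⟨fun x => if hx : ∃ i, g i = x then h hx.choose else (τ ⟨x, hx⟩).1, by
      intro x y hxy
      dsimp only at hxy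
      split_ifs at hxy with hx hy hy
      · rw [← hx.choose_spec, ← hy.choose_spec, h.injective hxy]
      · exact absurd ⟨_, hxy⟩ (τ ⟨y, hy⟩).2
      · exact absurd ⟨_, hxy.symm⟩ (τ ⟨x, hx⟩).2
      · exact congrArg Subtype.val (τ.injective (Subtype.ext hxy))⟩, by
      intro i
      have hi : ∃ j, g j = g i := ⟨i, rfl⟩
      have : hi.choose = i := g.injective hi.choose_spec
      exact (dif_pos hi).trans (congrArg h this)⟩
    left_inv := by
      rintro ⟨σ, hσ⟩
      refine Subtype.ext (Function.Embedding.ext fun x => ?_)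
      by_cases hx : ∃ i, g i = x
      · exact (dif_pos hx).trans ((hσ _).symm.trans (congrArg σ hx.choose_spec))
      · exact dif_neg hx
    right_inv := by
      intro τ
      exact Function.Embedding.ext fun x => Subtype.ext (dif_neg x.2) }

open Classical in
theorem card_filter_embedding_eq {α β : Type*} [Fintype α] [Fintype β] {k : ℕ}
    (g : Fin k ↪ α) (h : Fin k ↪ β) :
    (Finset.univ.filter fun σ : α ↪ β => ∀ i, σ (g i) = h i).card =
      (Fintype.card β - k).descFactorial (Fintype.card α - k) := by
  rw [← Fintype.card_subtype, Fintype.card_congr (embeddingExtensionEquiv g h),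
    Fintype.card_embedding_eq, Fintype.card_compl_set, Fintype.card_compl_set,
    Set.card_range_of_injective g.injective, Set.card_range_of_injective h.injective,
    Fintype.card_fin]

end Embeddings

/-! ### Counting copies of a graph through one or two vertex pairs -/

section GraphCounts

variable {v n : ℕ}

open Classical in
/-- The vertex pairs which are images of edges of `H` under `σ`. -/
noncomputable def imagePairs (H : SimpleGraph (Fin v)) (σ : Fin v ↪ Fin n) :
    Finset (VertexPair n) :=
  Finset.univ.filter fun r => ∃ a b, H.Adj a b ∧ σ a = r.1.1 ∧ σ b = r.1.2

theorem mem_imagePairs {H : SimpleGraph (Fin v)} {σ : Fin v ↪ Fin n} {r : VertexPair n} :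
    r ∈ imagePairs H σ ↔ ∃ a b, H.Adj a b ∧ σ a = r.1.1 ∧ σ b = r.1.2 := by
  simp [imagePairs]

theorem injCount_eq_sum_mono (H : SimpleGraph (Fin v)) (x : GraphConfig n) :
    (injCount H x : ℝ) = ∑ σ : Fin v ↪ Fin n, Glauber.mono (imagePairs H σ) x := by
  classical
  rw [injCount, Nat.card_eq_fintype_card, Fintype.card_subtype, Finset.card_filter, Nat.cast_sum]
  refine Finset.sum_congr rfl fun σ _ => ?_
  rw [Glauber.mono_eq, Nat.cast_ite, Nat.cast_one, Nat.cast_zero]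
  have hiff : (∀ a b, H.Adj a b → ∀ h : σ a < σ b, x ⟨(σ a, σ b), h⟩ = true) ↔
      ∀ r ∈ imagePairs H σ, x r = true := by
    refine ⟨fun h r hr => ?_, fun h a b hab hlt => ?_⟩
    · obtain ⟨a, b, hab, ha, hb⟩ := mem_imagePairs.1 hr
      have hlt : σ a < σ b := by rw [ha, hb]; exact r.2
      have := h a b hab hlt
      have e : (⟨(σ a, σ b), hlt⟩ : VertexPair n) = r := Subtype.ext (Prod.ext ha hb)
      rwa [e] at this
    · exact h _ (mem_imagePairs.2 ⟨a, b, hab, rfl, rfl⟩)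
  by_cases h : ∀ r ∈ imagePairs H σ, x r = true
  · rw [if_pos h, if_pos (hiff.2 h)]
  · rw [if_neg h, if_neg (mt hiff.1 h)]

theorem card_imagePairs (H : SimpleGraph (Fin v)) (σ : Fin v ↪ Fin n) :
    (imagePairs H σ).card = H.edgeSet.ncard := by
  have hinj : Function.Injective fun r : VertexPair n => s(r.1.1, r.1.2) := by
    rintro ⟨⟨a, b⟩, hab⟩ ⟨⟨c, d⟩, hcd⟩ h
    rcases Sym2.eq_iff.1 h with ⟨h1, h2⟩ | ⟨h1, h2⟩
    · exact Subtype.ext (Prod.ext h1 h2)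
    · dsimp only at h1 h2 hab hcd
      subst h1 h2
      exact absurd hab hcd.asymm
  rw [← Set.ncard_image_of_injective H.edgeSet (Sym2.map.injective σ.injective),
    ← Set.ncard_coe_finset, ← Set.ncard_image_of_injective _ hinj]
  congr 1
  ext z
  constructor
  · rintro ⟨r, hr, rfl⟩
    obtain ⟨a, b, hab, ha, hb⟩ := mem_imagePairs.1 hr
    exact ⟨s(a, b), hab, by simp [ha, hb]⟩
  · rintro ⟨w, hw, rfl⟩
    induction w using Sym2.ind with
    | _ a b =>
      have hab : H.Adj a b := hw
      rcases lt_or_gt_of_ne (σ.injective.ne hab.ne) with h | h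
      · exact ⟨⟨(σ a, σ b), h⟩, mem_imagePairs.2 ⟨a, b, hab, rfl, rfl⟩, rfl⟩
      · exact ⟨⟨(σ b, σ a), h⟩, mem_imagePairs.2 ⟨b, a, hab.symm, rfl, rfl⟩, Sym2.eq_swap⟩

/-- An embedding covering `s` sends exactly one of the `2 e` darts of `H` onto `s` with its
orientation; the other `v - 2` vertices are then free. -/
theorem card_filter_mem_imagePairs (H : SimpleGraph (Fin v)) (s : VertexPair n) :
    (Finset.univ.filter fun σ => s ∈ imagePairs H σ).card =
      2 * H.edgeSet.ncard * (n - 2).descFactorial (v - 2) := by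
  classical
  have e1 : (Finset.univ.filter fun σ => s ∈ imagePairs H σ) =
      (Finset.univ : Finset H.Dart).biUnion fun d =>
        Finset.univ.filter fun σ : Fin v ↪ Fin n => σ d.fst = s.1.1 ∧ σ d.snd = s.1.2 := by
    ext σ
    simp only [Finset.mem_filter, Finset.mem_univ, true_and, Finset.mem_biUnion, mem_imagePairs]
    exact ⟨fun ⟨a, b, hab, h⟩ => ⟨⟨(a, b), hab⟩, h⟩, fun ⟨d, h⟩ => ⟨d.fst, d.snd, d.adj, h⟩⟩
  rw [e1, Finset.card_biUnion]
  · have e2 : ∀ d : H.Dart, (Finset.univ.filter fun σ : Fin v ↪ Fin n =>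
        σ d.fst = s.1.1 ∧ σ d.snd = s.1.2).card = (n - 2).descFactorial (v - 2) := by
      intro d
      have h1 : Function.Injective ![d.fst, d.snd] := by
        simp [Function.Injective, Fin.forall_fin_two, d.fst_ne_snd, d.fst_ne_snd.symm]
      have h2 : Function.Injective ![s.1.1, s.1.2] := by
        simp [Function.Injective, Fin.forall_fin_two, s.2.ne, s.2.ne']
      have := card_filter_embedding_eq (⟨_, h1⟩ : Fin 2 ↪ Fin v) (⟨_, h2⟩ : Fin 2 ↪ Fin n)
      simpa [Fin.forall_fin_two] using this
    rw [Finset.sum_congr rfl fun d _ => e2 d, Finset.sum_const, Finset.card_univ,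
      H.dart_card_eq_twice_card_edges, smul_eq_mul, Set.ncard_eq_toFinset_card',
      SimpleGraph.edgeFinset]
  · intro d _ d' _ hne
    rw [Function.onFun, Finset.disjoint_left]
    intro σ h1 h2
    simp only [Finset.mem_filter, Finset.mem_univ, true_and] at h1 h2
    exact hne (SimpleGraph.Dart.ext _ _ (Prod.ext (σ.injective (h1.1.trans h2.1.symm))
      (σ.injective (h1.2.trans h2.2.symm))))

/-- A third prescribed value gains a factor `n`: unless the set is empty, `v - 3` vertices remain
free, and `n (n - 3)_(v - 3) ≤ n (n - 1)_(v - 3) = (n)_(v - 2)` for falling factorials. -/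
theorem mul_card_filter_three_le {i j w : Fin n} (hij : i ≠ j) (hwi : w ≠ i) (hwj : w ≠ j)
    (a b c : Fin v) :
    n * (Finset.univ.filter fun σ : Fin v ↪ Fin n => σ a = i ∧ σ b = j ∧ σ c = w).card ≤
      n.descFactorial (v - 2) := by
  classical
  rcases (Finset.univ.filter fun σ : Fin v ↪ Fin n =>
    σ a = i ∧ σ b = j ∧ σ c = w).eq_empty_or_nonempty with h | ⟨σ, hσ⟩
  · simp [h]
  obtain ⟨rfl, rfl, rfl⟩ := (Finset.mem_filter.1 hσ).2
  have hab : a ≠ b := fun h => hij (by rw [h])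
  have hca : c ≠ a := fun h => hwi (by rw [h])
  have hcb : c ≠ b := fun h => hwj (by rw [h])
  have h1 : Function.Injective ![a, b, c] := by
    simp [Function.Injective, Fin.forall_fin_succ, hab, hab.symm, hca, hca.symm, hcb, hcb.symm]
  have h2 : Function.Injective ![σ a, σ b, σ c] := by
    simp [Function.Injective, Fin.forall_fin_succ, hab, hab.symm, hca, hca.symm, hcb, hcb.symm]
  have key := card_filter_embedding_eq (⟨_, h1⟩ : Fin 3 ↪ Fin v) (⟨_, h2⟩ : Fin 3 ↪ Fin n)
  have hv : 3 ≤ v := by simpa using Fintype.card_le_of_injective _ h1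
  have hn : 3 ≤ n := by simpa using Fintype.card_le_of_injective _ h2
  simp only [Fin.forall_fin_succ, Function.Embedding.coeFn_mk, Fintype.card_fin] at key
  have key2 : (Finset.univ.filter fun τ : Fin v ↪ Fin n =>
      τ a = σ a ∧ τ b = σ b ∧ τ c = σ c).card = (n - 3).descFactorial (v - 3) := by
    rw [← key]
    congr 1
    ext τ
    simp
  rw [key2]
  obtain ⟨m, rfl⟩ : ∃ m, n = m + 1 := ⟨n - 1, by omega⟩
  obtain ⟨k, rfl⟩ : ∃ k, v = k + 3 := ⟨v - 3, by omega⟩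
  rw [show k + 3 - 2 = k + 1 by omega, Nat.succ_descFactorial_succ]
  exact Nat.mul_le_mul_left _ (Nat.descFactorial_le _ (by omega))

/-- A pair `r ≠ s` has an endpoint `w` outside `s`, so three values are prescribed; `v ^ 3` counts
the possible preimages. This makes the variance of the normalised counts of order `1 / n`. -/
theorem mul_card_filter_mem_mem_imagePairs_le (H : SimpleGraph (Fin v)) {s r : VertexPair n}
    (hrs : r ≠ s) :
    n * (Finset.univ.filter fun σ => s ∈ imagePairs H σ ∧ r ∈ imagePairs H σ).card ≤
      v ^ 3 * n.descFactorial (v - 2) := by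
  classical
  obtain ⟨w, hwr, hwi, hwj⟩ : ∃ w, (w = r.1.1 ∨ w = r.1.2) ∧ w ≠ s.1.1 ∧ w ≠ s.1.2 := by
    by_contra! h
    have h1 := h _ (Or.inl rfl)
    have h2 := h _ (Or.inr rfl)
    have hr := r.2
    have hs := s.2
    refine hrs (Subtype.ext (Prod.ext ?_ ?_))
    · by_contra h3
      have h4 := h1 h3
      by_cases h5 : r.1.2 = s.1.1
      · rw [h4, h5] at hr; exact absurd hr hs.asymm
      · rw [h4, h2 h5] at hr; exact absurd hr (lt_irrefl _)
    · by_contra h3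
      have h4 : r.1.2 = s.1.1 := by by_contra h4; exact h3 (h2 h4)
      by_cases h5 : r.1.1 = s.1.1
      · rw [h4, h5] at hr; exact absurd hr (lt_irrefl _)
      · rw [h4, h1 h5] at hr; exact absurd hr hs.asymm
  have hsub : (Finset.univ.filter fun σ => s ∈ imagePairs H σ ∧ r ∈ imagePairs H σ) ⊆
      (Finset.univ : Finset (Fin v × Fin v × Fin v)).biUnion fun t =>
        Finset.univ.filter fun σ : Fin v ↪ Fin n =>
          σ t.1 = s.1.1 ∧ σ t.2.1 = s.1.2 ∧ σ t.2.2 = w := by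
    intro σ hσ
    simp only [Finset.mem_filter, Finset.mem_univ, true_and, mem_imagePairs] at hσ
    obtain ⟨⟨a, b, -, ha, hb⟩, ⟨c, d, -, hc, hd⟩⟩ := hσ
    simp only [Finset.mem_biUnion, Finset.mem_filter, Finset.mem_univ, true_and]
    rcases hwr with h | h
    · exact ⟨(a, b, c), ha, hb, hc.trans h.symm⟩
    · exact ⟨(a, b, d), ha, hb, hd.trans h.symm⟩
  calc _ ≤ n * ∑ t : Fin v × Fin v × Fin v, (Finset.univ.filter fun σ : Fin v ↪ Fin n =>
          σ t.1 = s.1.1 ∧ σ t.2.1 = s.1.2 ∧ σ t.2.2 = w).card :=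
        Nat.mul_le_mul_left _ ((Finset.card_le_card hsub).trans Finset.card_biUnion_le)
    _ ≤ ∑ t : Fin v × Fin v × Fin v, n.descFactorial (v - 2) := by
        rw [Finset.mul_sum]
        exact Finset.sum_le_sum fun t _ => mul_card_filter_three_le s.2.ne hwi hwj _ _ _
    _ = _ := by
        simp only [Finset.sum_const, Finset.card_univ, Fintype.card_prod, Fintype.card_fin,
          smul_eq_mul]
        ring

theorem tendsto_descFactorial_sub_two_div (k : ℕ) :
    Tendsto (fun n : ℕ => ((n - 2).descFactorial k : ℝ) / n.descFactorial k) atTop (𝓝 1) := by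
  have h1 : Tendsto (fun n : ℕ => (1 - ((k + 1 : ℕ) : ℝ) / n) ^ k) atTop (𝓝 1) := by
    simpa using ((tendsto_const_div_atTop_nhds_zero_nat ((k + 1 : ℕ) : ℝ)).const_sub 1).pow k
  refine tendsto_of_tendsto_of_tendsto_of_le_of_le' h1 tendsto_const_nhds ?_ ?_
  · filter_upwards [eventually_ge_atTop (k + 2)] with n hn
    have hn0 : (0 : ℝ) < n := by exact_mod_cast (by omega : 0 < n)
    have hD : (0 : ℝ) < n.descFactorial k := by
      exact_mod_cast Nat.descFactorial_pos.2 (by omega)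
    have h2 : (n - (k + 1)) ^ k ≤ (n - 2).descFactorial k := by
      have := Nat.pow_sub_le_descFactorial (n - 2) k
      rwa [show n - 2 + 1 - k = n - (k + 1) by omega] at this
    have h3 := Nat.descFactorial_le_pow n k
    have e : 1 - ((k + 1 : ℕ) : ℝ) / n = ((n - (k + 1) : ℕ) : ℝ) / n := by
      rw [Nat.cast_sub (by omega)]; field_simp
    rw [e, div_pow]
    exact div_le_div₀ (by positivity) (by exact_mod_cast h2) hD (by exact_mod_cast h3)
  · filter_upwards [eventually_ge_atTop k] with n hn
    refine div_le_one_of_le₀ ?_ (by positivity)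
    exact_mod_cast Nat.descFactorial_le _ (Nat.sub_le _ _)

end GraphCounts

/-! ### One stationary step in terms of conditional probabilities -/

theorem hammingDist_update {R : Type*} [Fintype R] [DecidableEq R] (x : R → Bool) (s : R)
    (b : Bool) : hammingDist x (Function.update x s b) = if x s = b then 0 else 1 := by
  split_ifs with h
  · rw [← h, Function.update_eq_self, hammingDist_self]
  · rw [hammingDist, Finset.card_eq_one]
    refine ⟨s, ?_⟩
    ext r
    simp only [Finset.mem_filter, Finset.mem_univ, true_and, Finset.mem_singleton]
    by_cases hr : r = s
    · subst hr; simp [h]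
    · simp [hr]

namespace ERGM

variable (M : ERGM) {n : ℕ}

theorem sum_weight_pos : 0 < ∑ y : GraphConfig n, M.weight y :=
  Finset.sum_pos (fun _ _ => Real.exp_pos _) Finset.univ_nonempty

theorem prob_pos (x : GraphConfig n) : 0 < M.prob x :=
  div_pos (Real.exp_pos _) M.sum_weight_pos

theorem sum_prob : ∑ x : GraphConfig n, M.prob x = 1 := by
  unfold prob
  rw [← Finset.sum_div, div_self M.sum_weight_pos.ne']

theorem sum_transition_mul (x : GraphConfig n) (f : GraphConfig n → ℝ) :
    ∑ y, M.transition x y * f y = Glauber.glauber (Glauber.condTrue M.prob) f x := by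
  unfold transition Glauber.glauber
  simp only [mul_assoc]
  rw [← Finset.mul_sum]
  congr 1
  simp only [Finset.sum_mul]
  rw [Finset.sum_comm]
  refine Finset.sum_congr rfl fun s _ => ?_
  simp only [add_mul, Finset.sum_add_distrib, mul_assoc, ← Finset.mul_sum, ite_mul, one_mul,
    zero_mul, Finset.sum_ite_eq', Finset.mem_univ, if_true]
  rfl

theorem sum_prob_mul_hammingDist :
    ∑ x : GraphConfig n, M.prob x * ∑ y, M.transition x y * (hammingDist x y : ℝ) =
      ∑ x : GraphConfig n, M.prob x * (1 / (Fintype.card (VertexPair n) : ℝ) *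
        ∑ s, 2 * (M.condProb s x * (1 - M.condProb s x))) := by
  simp only [sum_transition_mul, Glauber.glauber, mul_left_comm (M.prob _)]
  rw [← Finset.mul_sum, ← Finset.mul_sum]
  congr 1
  simp only [Finset.mul_sum]
  rw [Finset.sum_comm]
  nth_rewrite 2 [Finset.sum_comm]
  refine Finset.sum_congr rfl fun s _ => ?_
  -- The function is the chance that resampling at `s` changes `x s`. Averaging also over the old
  -- value of `x s` turns it into `2 p (1 - p)`.
  have h := Glauber.sum_mul_resample M.prob_pos s fun x : GraphConfig n =>
    if x s then 1 - M.condProb s x else M.condProb s x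
  have hu : ∀ (x : GraphConfig n) b, M.condProb s (Function.update x s b) = M.condProb s x :=
    fun x b => Glauber.condTrue_update _ _ _ _
  have hc : ∀ x : GraphConfig n, Glauber.condTrue M.prob s x = M.condProb s x := fun _ => rfl
  trans ∑ x : GraphConfig n, M.prob x * if x s then 1 - M.condProb s x else M.condProb s x
  · refine Finset.sum_congr rfl fun x _ => ?_
    simp only [Glauber.resample, hammingDist_update, hc]
    cases x s <;> simp
  · rw [← h]
    refine Finset.sum_congr rfl fun x _ => ?_
    simp only [Glauber.resample, hu, hc, Function.update_self]
    congr 1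
    simp only [if_true, Bool.false_eq_true, if_false]
    ring

variable [Nonempty (VertexPair n)]

theorem sum_prob_mul_transition (y : GraphConfig n) :
    ∑ x, M.prob x * M.transition x y = M.prob y := by
  have h := Glauber.sum_mul_glauber M.prob_pos (fun z : GraphConfig n => if z = y then 1 else 0)
  simp only [← sum_transition_mul, mul_ite, mul_one, mul_zero, Finset.sum_ite_eq',
    Finset.mem_univ, if_true] at h
  exact h

variable {M} {Ω : Type*} [MeasurableSpace Ω] {P : Measure Ω} [IsProbabilityMeasure P]
  {X : ℕ → Ω → GraphConfig n}

/-- The earliest states are summed out one at a time; stationarity keeps `M.prob` as the law of the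
next one. -/
theorem IsGlauberDynamics.law_Icc (hX : M.IsGlauberDynamics P X) (m : ℕ) :
    ∀ k ≤ m, ∀ x : ℕ → GraphConfig n, P.real {ω | ∀ i, k ≤ i → i ≤ m → X i ω = x i} =
      M.prob (x k) * ∏ i ∈ Finset.Ico k m, M.transition (x i) (x (i + 1)) := by
  intro k
  induction k with
  | zero =>
    intro _ x
    simpa using hX.law m x
  | succ k ih =>
    intro hk x
    have hx : ∀ z, ∀ i, k < i → Function.update x k z i = x i := fun z i hi =>
      Function.update_of_ne hi.ne' _ _
    have hset : {ω | ∀ i, k + 1 ≤ i → i ≤ m → X i ω = x i} =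
        ⋃ z ∈ (Finset.univ : Finset (GraphConfig n)),
          {ω | ∀ i, k ≤ i → i ≤ m → X i ω = Function.update x k z i} := by
      ext ω
      simp only [Set.mem_ofPred_eq, Set.mem_iUnion, Finset.mem_univ, exists_prop, true_and]
      constructor
      · intro h
        refine ⟨X k ω, fun i hi him => ?_⟩
        rcases hi.eq_or_lt with rfl | hlt
        · rw [Function.update_self]
        · rw [hx _ _ hlt, h i hlt him]
      · rintro ⟨z, hz⟩ i hi him
        rw [hz i (by omega) him, hx _ _ hi]
    rw [hset, measureReal_biUnion_finset]
    · simp only [ih (by omega)]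
      have e : ∀ z, M.prob (Function.update x k z k) * ∏ i ∈ Finset.Ico k m,
          M.transition (Function.update x k z i) (Function.update x k z (i + 1)) =
          (M.prob z * M.transition z (x (k + 1))) *
            ∏ i ∈ Finset.Ico (k + 1) m, M.transition (x i) (x (i + 1)) := by
        intro z
        rw [Finset.prod_eq_prod_Ico_succ_bot (by omega), Function.update_self,
          hx z (k + 1) (by omega), mul_assoc]
        congr 2
        refine Finset.prod_congr rfl fun i hi => ?_
        have := (Finset.mem_Ico.1 hi).1
        rw [hx z i (by omega), hx z (i + 1) (by omega)]
      simp only [e]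
      rw [← Finset.sum_mul, sum_prob_mul_transition]
    · intro z _ z' _ hne
      rw [Function.onFun, Set.disjoint_left]
      intro ω h h'
      refine hne ?_
      have h1 := h k le_rfl (by omega)
      have h2 := h' k le_rfl (by omega)
      rw [Function.update_self] at h1 h2
      exact h1.symm.trans h2
    · intro z _
      simp only [Set.ofPred_forall]
      exact MeasurableSet.iInter fun i => MeasurableSet.iInter fun _ =>
        MeasurableSet.iInter fun _ => hX.measurable i (measurableSet_singleton _)

theorem IsGlauberDynamics.integral_hammingDist (hX : M.IsGlauberDynamics P X) (u : ℕ) :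
    ∫ ω, (hammingDist (X u ω) (X (u + 1) ω) : ℝ) ∂P =
      ∑ x : GraphConfig n, M.prob x * ∑ y, M.transition x y * (hammingDist x y : ℝ) := by
  have hm : Measurable fun ω => (X u ω, X (u + 1) ω) :=
    (hX.measurable u).prodMk (hX.measurable (u + 1))
  have h1 : ∫ ω, (hammingDist (X u ω) (X (u + 1) ω) : ℝ) ∂P =
      ∫ z, (hammingDist z.1 z.2 : ℝ) ∂(P.map fun ω => (X u ω, X (u + 1) ω)) :=
    (integral_map (f := fun z : GraphConfig n × GraphConfig n => (hammingDist z.1 z.2 : ℝ))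
      hm.aemeasurable (measurable_of_finite _).aestronglyMeasurable).symm
  have := Measure.isProbabilityMeasure_map (μ := P) hm.aemeasurable
  rw [h1, integral_fintype Integrable.of_finite, Fintype.sum_prod_type]
  refine Finset.sum_congr rfl fun x _ => ?_
  rw [Finset.mul_sum]
  refine Finset.sum_congr rfl fun y _ => ?_
  have hlaw := hX.law_Icc (u + 1) u (Nat.le_succ u) fun i => if i = u then x else y
  simp only [Nat.Ico_succ_singleton, Finset.prod_singleton, if_true, Nat.succ_ne_self,
    if_false] at hlaw
  rw [map_measureReal_apply hm (measurableSet_singleton _), smul_eq_mul, ← mul_assoc, ← hlaw]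
  congr 2
  ext ω
  simp only [Set.mem_preimage, Set.mem_singleton_iff, Prod.mk.injEq, Set.mem_ofPred_eq]
  constructor
  · rintro ⟨h2, h3⟩ i hi hi'
    rcases hi.eq_or_lt with rfl | hlt
    · simpa using h2
    · obtain rfl : i = u + 1 := by omega
      simpa using h3
  · intro h
    exact ⟨by simpa using h u le_rfl (by omega), by simpa using h (u + 1) (by omega) le_rfl⟩

end ERGM

/-! ### The logistic function -/

theorem Real.abs_sigmoid_sub_le (x y : ℝ) :
    |Real.sigmoid x - Real.sigmoid y| ≤ 1 / 4 * |x - y| := by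
  refine Convex.norm_image_sub_le_of_norm_hasDerivWithin_le (s := Set.univ)
    (fun z _ => (Real.hasDerivAt_sigmoid z).hasDerivWithinAt) (fun z _ => ?_) convex_univ
    (Set.mem_univ y) (Set.mem_univ x)
  have h0 := Real.sigmoid_nonneg z
  have h1 := Real.sigmoid_le_one z
  rw [Real.norm_eq_abs, abs_of_nonneg (mul_nonneg h0 (by linarith))]
  nlinarith [sq_nonneg (Real.sigmoid z - 1 / 2)]

theorem Real.one_add_tanh_div_two (x : ℝ) : (1 + Real.tanh x) / 2 = Real.sigmoid (2 * x) := by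
  rw [Real.tanh_eq_sinh_div_cosh, Real.sinh_eq, Real.cosh_eq, Real.sigmoid_def,
    show -(2 * x) = -x + -x by ring, Real.exp_add, Real.exp_neg]
  have := Real.exp_pos x
  field_simp
  ring

/-! ### Concentration of the subgraph counts under the product measure -/

section Deviation

variable {v n : ℕ}

/-- The square root bounds the fluctuation; the last term is the bias of the mean, as `(n - 2)_(v -
2)` embeddings per dart are normalised by `(n)_(v - 2)`. -/
theorem sum_bern_mul_abs_localCount_imagePairs_le (H : SimpleGraph (Fin v)) (hv : v ≤ n) {a : ℝ}
    (h0 : 0 < a) (h1 : a < 1) (s : VertexPair n) :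
    ∑ x, Glauber.bern a x * |Glauber.localCount (imagePairs H) s x / n.descFactorial (v - 2) -
        2 * H.edgeSet.ncard * a ^ (H.edgeSet.ncard - 1)| ≤
      √(((2 * H.edgeSet.ncard * (H.edgeSet.ncard - 1) * v ^ 3 : ℕ) : ℝ) / n) +
        2 * H.edgeSet.ncard *
          |((n - 2).descFactorial (v - 2) : ℝ) / n.descFactorial (v - 2) - 1| := by
  set e := H.edgeSet.ncard
  set D := n.descFactorial (v - 2) with hD
  set d := 2 * e * (n - 2).descFactorial (v - 2) with hd
  have hn : 0 < n := by have := s.1.1.2; omega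
  have hDpos : 0 < D := Nat.descFactorial_pos.2 (by omega)
  have hDR : (0 : ℝ) < D := by exact_mod_cast hDpos
  have hnR : (0 : ℝ) < n := by exact_mod_cast hn
  have hdev := Glauber.sum_bern_mul_abs_localCount_sub_le h0 h1 (card_imagePairs (n := n) H) s
    (card_filter_mem_imagePairs H s) (c := v ^ 3 * D / n) fun r hr => by
      rw [Nat.le_div_iff_mul_le hn, mul_comm]
      exact mul_card_filter_mem_mem_imagePairs_le H hr
  have hcount : (d * ((e - 1) * (v ^ 3 * D / n))) * n ≤ (2 * e * (e - 1) * v ^ 3) * D ^ 2 := by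
    have h2 : d ≤ 2 * e * D := Nat.mul_le_mul_left _ (Nat.descFactorial_le _ (Nat.sub_le _ _))
    have h3 := Nat.div_mul_le_self (v ^ 3 * D) n
    calc (d * ((e - 1) * (v ^ 3 * D / n))) * n = d * ((e - 1) * (v ^ 3 * D / n * n)) := by ring
      _ ≤ 2 * e * D * ((e - 1) * (v ^ 3 * D)) := by gcongr
      _ = _ := by ring
  have hsqrt : √((d * ((e - 1) * (v ^ 3 * D / n)) : ℕ) : ℝ) / D ≤
      √(((2 * e * (e - 1) * v ^ 3 : ℕ) : ℝ) / n) := by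
    rw [div_le_iff₀ hDR]
    refine Real.sqrt_le_iff.2 ⟨by positivity, ?_⟩
    rw [mul_pow, Real.sq_sqrt (by positivity)]
    rw [div_mul_eq_mul_div, le_div_iff₀ hnR]
    exact_mod_cast hcount
  have ha1 : a ^ (e - 1) ≤ 1 := pow_le_one₀ h0.le h1.le
  have hpt : ∀ x : GraphConfig n, |Glauber.localCount (imagePairs H) s x / D -
      2 * e * a ^ (e - 1)| ≤ |Glauber.localCount (imagePairs H) s x - d * a ^ (e - 1)| / D +
        2 * e * |((n - 2).descFactorial (v - 2) : ℝ) / D - 1| := by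
    intro x
    have hE : Glauber.localCount (imagePairs H) s x / D - 2 * e * a ^ (e - 1) =
        (Glauber.localCount (imagePairs H) s x - d * a ^ (e - 1)) / D +
        a ^ (e - 1) * (2 * e * (((n - 2).descFactorial (v - 2) : ℝ) / D - 1)) := by
      rw [hd]; push_cast; field_simp; ring
    rw [hE]
    refine (abs_add_le _ _).trans (add_le_add ?_ ?_)
    · rw [abs_div, abs_of_pos hDR]
    · rw [abs_mul, abs_mul, abs_of_nonneg (by positivity : 0 ≤ a ^ (e - 1)),
        abs_of_nonneg (by positivity : (0 : ℝ) ≤ 2 * e)]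
      exact mul_le_of_le_one_left (by positivity) ha1
  calc _ ≤ ∑ x, Glauber.bern a x *
        (|Glauber.localCount (imagePairs H) s x - d * a ^ (e - 1)| / D +
        2 * e * |((n - 2).descFactorial (v - 2) : ℝ) / D - 1|) :=
        Finset.sum_le_sum fun x _ =>
          mul_le_mul_of_nonneg_left (hpt x) (Glauber.bern_pos h0 h1 x).le
    _ = (∑ x, Glauber.bern a x *
          |Glauber.localCount (imagePairs H) s x - d * a ^ (e - 1)|) / D +
        2 * e * |((n - 2).descFactorial (v - 2) : ℝ) / D - 1| := by
        simp only [mul_add, Finset.sum_add_distrib, ← Finset.sum_mul, Glauber.sum_bern, one_mul,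
          Finset.sum_div, mul_div_assoc]
    _ ≤ _ := add_le_add ((div_le_div_of_nonneg_right hdev hDR.le).trans hsqrt) le_rfl

end Deviation

/-! ### Influence and concentration of the conditional edge probabilities -/

namespace ERGM

variable (M : ERGM) {n : ℕ}

theorem deriv_absPhi_one :
    deriv M.absPhi 1 = ∑ l, |M.β l| * M.numEdges l * ((M.numEdges l - 1 : ℕ) : ℝ) := by
  have h : HasDerivAt M.absPhi
      (∑ l, |M.β l| * M.numEdges l *
        (((M.numEdges l - 1 : ℕ) : ℝ) * 1 ^ (M.numEdges l - 1 - 1))) 1 := by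
    unfold absPhi
    exact HasDerivAt.fun_sum fun l _ => (hasDerivAt_pow _ _).const_mul _
  simpa using h.deriv

theorem phi_eq_sigmoid (a : ℝ) : M.phi a = Real.sigmoid (2 * M.Phi a) :=
  Real.one_add_tanh_div_two _

/-- The partition function cancels, and the log-odds are the discrete derivative of the exponent at
`s`. -/
theorem condProb_eq_sigmoid (s : VertexPair n) (x : GraphConfig n) :
    M.condProb s x = Real.sigmoid (∑ l, M.β l *
      (Glauber.localCount (imagePairs (M.H l)) s x / n.descFactorial (M.v l - 2))) := by
  have h : ∑ l, M.β l *
      (Glauber.localCount (imagePairs (M.H l)) s x / n.descFactorial (M.v l - 2)) =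
      ∑ l, M.β l * scaledCount (M.H l) (Function.update x s true) -
        ∑ l, M.β l * scaledCount (M.H l) (Function.update x s false) := by
    rw [← Finset.sum_sub_distrib]
    refine Finset.sum_congr rfl fun l _ => ?_
    rw [scaledCount, scaledCount, injCount_eq_sum_mono, injCount_eq_sum_mono,
      ← Glauber.sum_mono_update_sub]
    ring
  have hZ := M.sum_weight_pos (n := n)
  rw [h, Real.sigmoid_def, neg_sub, Real.exp_sub, condProb, prob, prob]
  have h1 : 0 < M.weight (Function.update x s true) := Real.exp_pos _
  have h2 : 0 < M.weight (Function.update x s false) := Real.exp_pos _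
  change _ = (1 + M.weight (Function.update x s false) / M.weight (Function.update x s true))⁻¹
  field_simp

/-- Dobrushin's condition. The Lipschitz constant `1 / 4` of the logistic function times the
influence `2 e (e - 1)` on the normalised counts gives `e (e - 1) / 2` for each graph, weighted by
`|β|`. -/
theorem sum_abs_condProb_sub_le (hn : ∀ l, M.v l ≤ n) (r : VertexPair n) (z : GraphConfig n) :
    ∑ s ∈ Finset.univ.erase r, |M.condProb s (Function.update z r true) -
      M.condProb s (Function.update z r false)| ≤ 1 / 2 * deriv M.absPhi 1 := by
  set c : Fin (M.k + 1) → VertexPair n → GraphConfig n → ℝ :=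
    fun l s x => Glauber.localCount (imagePairs (M.H l)) s x with hc
  set D : Fin (M.k + 1) → ℝ := fun l => (n.descFactorial (M.v l - 2) : ℝ) with hD
  have hDpos : ∀ l, 0 < D l := fun l => by
    have := hn l
    exact Nat.cast_pos.2 (Nat.descFactorial_pos.2 (by omega))
  set x := Function.update z r true
  set y := Function.update z r false
  have hpt : ∀ s, |M.condProb s x - M.condProb s y| ≤
      ∑ l, 1 / 4 * (|M.β l| * (|c l s x - c l s y| / D l)) := by
    intro s
    rw [condProb_eq_sigmoid, condProb_eq_sigmoid, ← Finset.mul_sum]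
    refine (Real.abs_sigmoid_sub_le _ _).trans ?_
    refine mul_le_mul_of_nonneg_left ?_ (by norm_num)
    rw [← Finset.sum_sub_distrib]
    refine (Finset.abs_sum_le_sum_abs _ _).trans (Finset.sum_le_sum fun l _ => ?_)
    rw [← mul_sub, ← sub_div, abs_mul, abs_div, abs_of_pos (hDpos l)]
  have hl : ∀ l, ∑ s ∈ Finset.univ.erase r, |c l s x - c l s y| ≤
      2 * M.numEdges l * ((M.numEdges l - 1 : ℕ) : ℝ) * D l := by
    intro l
    refine (Glauber.sum_abs_localCount_sub_le (card_imagePairs (M.H l)) r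
      (d := 2 * M.numEdges l * n.descFactorial (M.v l - 2)) ?_ z).trans (le_of_eq ?_)
    · rw [card_filter_mem_imagePairs]
      exact Nat.mul_le_mul_left _ (Nat.descFactorial_le _ (Nat.sub_le _ _))
    · simp only [hD, numEdges]
      push_cast
      ring
  calc _ ≤ ∑ s ∈ Finset.univ.erase r, ∑ l, 1 / 4 * (|M.β l| * (|c l s x - c l s y| / D l)) :=
        Finset.sum_le_sum fun s _ => hpt s
    _ = ∑ l, 1 / 4 * (|M.β l| * ((∑ s ∈ Finset.univ.erase r, |c l s x - c l s y|) / D l)) := by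
        rw [Finset.sum_comm]
        simp only [Finset.mul_sum, Finset.sum_div]
    _ ≤ ∑ l, 1 / 4 * (|M.β l| * (2 * M.numEdges l * ((M.numEdges l - 1 : ℕ) : ℝ))) := by
        refine Finset.sum_le_sum fun l _ => ?_
        refine mul_le_mul_of_nonneg_left (mul_le_mul_of_nonneg_left ?_ (abs_nonneg _))
          (by norm_num)
        rw [div_le_iff₀ (hDpos l)]
        exact hl l
    _ = _ := by
        rw [deriv_absPhi_one, Finset.mul_sum]
        exact Finset.sum_congr rfl fun l _ => by ring

/-- A bound for the mean deviation of the conditional edge probabilities in the Erdős–Rényi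
graph. -/
noncomputable def deviation (n : ℕ) : ℝ :=
  ∑ l, 1 / 4 * (|M.β l| *
    (√(((2 * M.numEdges l * (M.numEdges l - 1) * M.v l ^ 3 : ℕ) : ℝ) / n) +
      2 * M.numEdges l * |((n - 2).descFactorial (M.v l - 2) : ℝ) /
        n.descFactorial (M.v l - 2) - 1|))

theorem tendsto_deviation : Tendsto M.deviation atTop (𝓝 0) := by
  have h : Tendsto M.deviation atTop
      (𝓝 (∑ l, 1 / 4 * (|M.β l| * (√0 + 2 * M.numEdges l * |(1 : ℝ) - 1|)))) := by
    refine tendsto_finsetSum _ fun l _ => Tendsto.const_mul _ (Tendsto.const_mul _ ?_)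
    exact (tendsto_const_div_atTop_nhds_zero_nat _).sqrt.add
      (((tendsto_descFactorial_sub_two_div _).sub_const 1).abs.const_mul _)
  simpa using h

/-- The fixed point equation enters here: `a` is the logistic function at `2 Φ(a)`, the approximate
mean of the log-odds under the product measure of parameter `a`. -/
theorem sum_bern_mul_abs_condProb_sub_le (hn : ∀ l, M.v l ≤ n) {a : ℝ} (h0 : 0 < a) (h1 : a < 1)
    (hfix : M.phi a = a) (s : VertexPair n) :
    ∑ x, Glauber.bern a x * |M.condProb s x - a| ≤ M.deviation n := by
  set g : Fin (M.k + 1) → GraphConfig n → ℝ := fun l x =>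
    |Glauber.localCount (imagePairs (M.H l)) s x / n.descFactorial (M.v l - 2) -
      2 * M.numEdges l * a ^ (M.numEdges l - 1)| with hg
  have hpt : ∀ x, |M.condProb s x - a| ≤ ∑ l, 1 / 4 * (|M.β l| * g l x) := by
    intro x
    nth_rewrite 1 [← hfix]
    rw [phi_eq_sigmoid, condProb_eq_sigmoid, ← Finset.mul_sum]
    refine (Real.abs_sigmoid_sub_le _ _).trans (mul_le_mul_of_nonneg_left ?_ (by norm_num))
    rw [Phi, Finset.mul_sum, ← Finset.sum_sub_distrib]
    refine (Finset.abs_sum_le_sum_abs _ _).trans (Finset.sum_le_sum fun l _ => le_of_eq ?_)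
    rw [hg, ← abs_mul]
    congr 1
    ring
  calc _ ≤ ∑ x, Glauber.bern a x * ∑ l, 1 / 4 * (|M.β l| * g l x) :=
        Finset.sum_le_sum fun x _ =>
          mul_le_mul_of_nonneg_left (hpt x) (Glauber.bern_pos h0 h1 x).le
    _ = ∑ l, 1 / 4 * (|M.β l| * ∑ x, Glauber.bern a x * g l x) := by
        simp only [Finset.mul_sum]
        rw [Finset.sum_comm]
        exact Finset.sum_congr rfl fun l _ => Finset.sum_congr rfl fun x _ => by ring
    _ ≤ _ := Finset.sum_le_sum fun l _ => mul_le_mul_of_nonneg_left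
        (mul_le_mul_of_nonneg_left
          (sum_bern_mul_abs_localCount_imagePairs_le (M.H l) (hn l) h0 h1 s) (abs_nonneg _))
        (by norm_num)

theorem abs_sum_prob_mul_condProb_sub_le [Nonempty (VertexPair n)] (hn : ∀ l, M.v l ≤ n) {a : ℝ}
    (ha : M.HighTemperature a) :
    |∑ x : GraphConfig n, M.prob x * (1 / (Fintype.card (VertexPair n) : ℝ) *
        ∑ s, 2 * (M.condProb s x * (1 - M.condProb s x))) - 2 * a * (1 - a)| ≤
      2 / (1 - 1 / 2 * deriv M.absPhi 1) * M.deviation n := by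
  -- The comparison requires full support of the product measure, hence `0 < a < 1`.
  have h0 : 0 < a := by rw [← ha.fixed, phi_eq_sigmoid]; exact Real.sigmoid_pos _
  have h1 : a < 1 := by rw [← ha.fixed, phi_eq_sigmoid]; exact Real.sigmoid_lt_one _
  have hN : (0 : ℝ) < Fintype.card (VertexPair n) := by exact_mod_cast Fintype.card_pos
  have hδ1 := ha.contraction
  have hδ := M.sum_abs_condProb_sub_le hn
  set δ := 1 / 2 * deriv M.absPhi 1
  set N : ℝ := (Fintype.card (VertexPair n) : ℝ) with hNdef
  set F : GraphConfig n → ℝ := fun x =>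
    1 / N * ∑ s, 2 * (M.condProb s x * (1 - M.condProb s x)) with hF
  have hquad : ∀ p ∈ Set.Icc (0 : ℝ) 1, ∀ q ∈ Set.Icc (0 : ℝ) 1,
      |2 * (p * (1 - p)) - 2 * (q * (1 - q))| ≤ 2 * |p - q| := by
    rintro p ⟨hp0, hp1⟩ q ⟨hq0, hq1⟩
    rw [show 2 * (p * (1 - p)) - 2 * (q * (1 - q)) = (2 * (1 - p - q)) * (p - q) by ring, abs_mul]
    refine mul_le_mul_of_nonneg_right ?_ (abs_nonneg _)
    rw [abs_le]
    constructor <;> linarith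
  have hp : ∀ (s : VertexPair n) x, M.condProb s x ∈ Set.Icc (0 : ℝ) 1 :=
    fun s x => Glauber.condTrue_mem M.prob_pos s x
  have hdev : ∑ s : VertexPair n, ∑ x, Glauber.bern a x * |M.condProb s x - a| ≤
      N * M.deviation n := by
    refine (Finset.sum_le_sum fun s _ =>
      M.sum_bern_mul_abs_condProb_sub_le hn h0 h1 ha.fixed s).trans (le_of_eq ?_)
    rw [Finset.sum_const, Finset.card_univ, nsmul_eq_mul]
  -- The conditional probability at `r` ignores the coordinate `r`, and `p ↦ 2 p (1 - p)` is
  -- 2-Lipschitz on `[0, 1]`, so the influence bound `δ` applies.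
  have hLip : Glauber.FlipLipschitz (2 * δ / N) F := by
    intro z r
    simp only [hF]
    rw [← mul_sub, ← Finset.sum_sub_distrib, abs_mul, abs_of_pos (by positivity),
      show 2 * δ / N = 1 / N * (2 * δ) by ring]
    refine mul_le_mul_of_nonneg_left ?_ (by positivity)
    have hr : ∀ b, M.condProb r (Function.update z r b) = M.condProb r z :=
      fun b => Glauber.condTrue_update _ _ _ _
    rw [← Finset.add_sum_erase _ _ (Finset.mem_univ r), hr, hr, sub_self, zero_add]
    refine (Finset.abs_sum_le_sum_abs _ _).trans
      ((Finset.sum_le_sum fun s _ => hquad _ (hp s _) _ (hp s _)).trans ?_)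
    rw [← Finset.mul_sum]
    exact mul_le_mul_of_nonneg_left (hδ r z) (by norm_num)
  have hcmp := Glauber.abs_sum_sub_sum_le M.prob_pos (Glauber.bern_pos h0 h1) M.sum_prob
    (Glauber.sum_bern a) hδ1 hδ hLip
  simp only [Glauber.condTrue_bern h0 h1] at hcmp
  have hδ0 : 0 ≤ δ := (Finset.sum_nonneg fun _ _ => abs_nonneg _).trans
    (hδ (Classical.arbitrary _) fun _ => true)
  have hcmp2 : |∑ x, M.prob x * F x - ∑ x, Glauber.bern a x * F x| ≤
      2 * δ / (1 - δ) * M.deviation n := by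
    refine hcmp.trans ((mul_le_mul_of_nonneg_left hdev
      (div_nonneg (by positivity) (by linarith))).trans (le_of_eq ?_))
    have : 1 - δ ≠ 0 := by linarith
    field_simp
  have hmean : |∑ x, Glauber.bern a x * F x - 2 * a * (1 - a)| ≤ 2 * M.deviation n := by
    have e : ∑ x, Glauber.bern a x * F x - 2 * a * (1 - a) =
        1 / N * ∑ s, ∑ x : GraphConfig n, Glauber.bern a x *
          (2 * (M.condProb s x * (1 - M.condProb s x)) - 2 * (a * (1 - a))) := by
      simp only [mul_sub (Glauber.bern a _), Finset.sum_sub_distrib]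
      simp only [← Finset.sum_mul, Glauber.sum_bern, hF]
      rw [Finset.sum_comm, Finset.sum_const, Finset.card_univ, nsmul_eq_mul,
        mul_sub (1 / N), Finset.mul_sum]
      congr 1
      · refine Finset.sum_congr rfl fun x _ => ?_
        rw [mul_left_comm, Finset.mul_sum (a := Glauber.bern a x)]
      · rw [← hNdef]
        field_simp
    rw [e, abs_mul, abs_of_pos (by positivity : 0 < 1 / N)]
    calc _ ≤ 1 / N * ∑ s, ∑ x : GraphConfig n, 2 * (Glauber.bern a x * |M.condProb s x - a|) := by
          refine mul_le_mul_of_nonneg_left ?_ (by positivity)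
          refine (Finset.abs_sum_le_sum_abs _ _).trans (Finset.sum_le_sum fun s _ => ?_)
          refine (Finset.abs_sum_le_sum_abs _ _).trans (Finset.sum_le_sum fun x _ => ?_)
          have hb := Glauber.bern_pos h0 h1 x
          rw [abs_mul, abs_of_pos hb]
          exact (mul_le_mul_of_nonneg_left (hquad _ (hp s x) _ ha.mem) hb.le).trans_eq
            (mul_left_comm _ _ _)
      _ ≤ 1 / N * (2 * (N * M.deviation n)) := by
          simp only [← Finset.mul_sum]
          refine mul_le_mul_of_nonneg_left (mul_le_mul_of_nonneg_left hdev (by norm_num))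
            (by positivity)
      _ = _ := by field_simp
  -- The constants add up as `2 δ / (1 - δ) + 2 = 2 / (1 - δ)`.
  refine (abs_sub_le _ (∑ x, Glauber.bern a x * F x) _).trans
    ((add_le_add hcmp2 hmean).trans (le_of_eq ?_))
  have : 1 - δ ≠ 0 := by linarith
  field_simp
  ring

end ERGM

theorem mainTheorem2 (M : ERGM) (a : ℝ) (ha : M.HighTemperature a)
    {Ω : ℕ → Type*} [∀ n, MeasurableSpace (Ω n)]
    (P : (n : ℕ) → Measure (Ω n)) [∀ n, IsProbabilityMeasure (P n)]
    (X : (n : ℕ) → ℕ → Ω n → GraphConfig n)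
    (hX : ∀ n, (∀ l, M.v l ≤ n) → M.IsGlauberDynamics (P n) (X n))
    (u : ℕ → ℕ) :
    Tendsto
      (fun n => ∫ ω, (hammingDist (X n (u n) ω) (X n (u n + 1) ω) : ℝ) ∂(P n))
      atTop (𝓝 (2 * a * (1 - a))) := by
  rw [tendsto_iff_dist_tendsto_zero]
  have hlim : Tendsto (fun n => 2 / (1 - 1 / 2 * deriv M.absPhi 1) * M.deviation n) atTop
      (𝓝 0) := by
    simpa using M.tendsto_deviation.const_mul (2 / (1 - 1 / 2 * deriv M.absPhi 1))
  refine squeeze_zero' (Eventually.of_forall fun _ => dist_nonneg) ?_ hlim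
  filter_upwards [eventually_ge_atTop 2,
    eventually_all.2 fun l => eventually_ge_atTop (M.v l)] with n hn2 hn
  have : Nonempty (VertexPair n) :=
    ⟨⟨(⟨0, by omega⟩, ⟨1, by omega⟩), by simp [Fin.lt_def]⟩⟩
  rw [Real.dist_eq, (hX n hn).integral_hammingDist, M.sum_prob_mul_hammingDist]
  exact M.abs_sum_prob_mul_condProb_sub_le hn ha
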